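/- Let $\Omega\subset\mathbb{R}^n$ be open. A \emph{positive stable solution} of $\Delta u=\frac1u$ on $\Omega$ is a function $u\in C^2(\Omega)$ with $u>0$ and $\Delta u=\frac1u$ on $\Omega$ such that $$\int_\Omega\frac{\zeta^2}{u^2}\,dx\le\int_\Omega|D\zeta|^2\,dx\qquad\text{for all }\zeta\in C_c^\infty(\Omega).$$ Let $(u_j)$ be a sequence of positive stable solutions of $\Delta u=\frac1u$ on $\Omega$ that converges locally uniformly on $\Omega$ to a function $u:\Omega\to\mathbb{R}$, and let $A=\{x\in\Omega: u(x)=0\}$ be the singular set of $u$. Then the Hausdorff dimension of $A$ satisfies $$\dim_{\mathcal H}(A)\le n-4-2\sqrt2,$$ where $\dim_{\mathcal H}(\emptyset)=-\infty$; in particular, $A=\emptyset$ if $n\le 6$. -/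

import Mathlib

open Set Filter MeasureTheory
open scoped ContDiff

/-- Test functions on `Ω`: smooth functions whose support is a compact subset of `Ω`. -/
structure IsTestFunction {n : ℕ} (Ω : Set (EuclideanSpace ℝ (Fin n)))
    (ζ : EuclideanSpace ℝ (Fin n) → ℝ) : Prop where
  contDiff : ContDiff ℝ ∞ ζ
  hasCompactSupport : HasCompactSupport ζ
  tsupport_subset : tsupport ζ ⊆ Ω

/-- `u` is a positive (classical, `C²`) solution of `Δ u = 1 / u` on the open set `Ω`.
The values of `u` outside `Ω` play no role. -/
structure IsPositiveSolution {n : ℕ} (Ω : Set (EuclideanSpace ℝ (Fin n)))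
    (u : EuclideanSpace ℝ (Fin n) → ℝ) : Prop where
  contDiffOn : ContDiffOn ℝ 2 u Ω
  pos : ∀ x ∈ Ω, 0 < u x
  laplacian_eq : ∀ x ∈ Ω, Laplacian.laplacian u x = 1 / u x

/-- The stability inequality `∫_Ω ζ² / u² ≤ ∫_Ω |Dζ|²` for all test functions `ζ` on `Ω`.
The operator norm of `fderiv ℝ ζ x` is the Euclidean norm of the gradient of `ζ` at `x`. -/
def IsStable {n : ℕ} (Ω : Set (EuclideanSpace ℝ (Fin n)))
    (u : EuclideanSpace ℝ (Fin n) → ℝ) : Prop :=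
  ∀ ζ : EuclideanSpace ℝ (Fin n) → ℝ, IsTestFunction Ω ζ →
    ∫ x in Ω, ζ x ^ 2 / u x ^ 2 ≤ ∫ x in Ω, ‖fderiv ℝ ζ x‖ ^ 2

/-- The singular set `{u = 0}` of a function `u` on `Ω`. -/
def singularSet {n : ℕ} (Ω : Set (EuclideanSpace ℝ (Fin n)))
    (u : EuclideanSpace ℝ (Fin n) → ℝ) : Set (EuclideanSpace ℝ (Fin n)) :=
  {x ∈ Ω | u x = 0}

open scoped Gradient Topology Convolution

/-! Negative powers of a stable solution `v` satisfy scale-invariant integral bounds. Test stability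
with `v ^ (-a) * φ` and the equation with `v ^ (-(2 * a + 1)) * φ ^ 2`. The two relations combine to
bound `∫ v ^ (-(2a+2)) φ²` by `∫ v ^ (-2a) |∇φ|²` as long as `a² < 2a + 1`, whose upper limit is `a
< 1 + √2` (`exists_integral_rpow_mul_sq_le`). Absorbing the right side gives `∫ v ^ (-(2a+2)) ≤ C R
^ (n-2a-2)` over a ball of radius `R / 2` (`exists_setIntegral_rpow_le`).

Conversely, `v` cannot grow fast away from a small value: its spherical growth is governed by `Δv =
1/v`, whose integral is controlled by the same estimate, so the mean of `v` over a ball of radius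
comparable to `r` is at most `C (v x + r)` (`exists_setIntegral_ball_le`). Hence `∫ v ^ (-q)` over
such a ball is at least `c r ^ n (v x + r) ^ (-q)` (`exists_le_setIntegral_rpow`).

With `q = 2a + 2`, compare both bounds on disjoint balls around `N` points of the singular set that
are `r`-separated, and let `j → ∞`: locally `N r ^ (n-q) ≤ C`. This packing bound gives dimension at
most `n - 2a - 2`, and forces this number to be nonnegative when the set is nonempty. Finally `a → 1
+ √2`. -/

/-- A globally defined positive `C²` function solving `Δ v = 1 / v` on `W` and satisfying the
stability inequality for all `C¹` test functions supported in `W`. -/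
structure IsStableSolutionOn {n : ℕ} (W : Set (EuclideanSpace ℝ (Fin n)))
    (v : EuclideanSpace ℝ (Fin n) → ℝ) : Prop where
  contDiff : ContDiff ℝ 2 v
  pos : ∀ x, 0 < v x
  laplacian_eq : ∀ x ∈ W, Laplacian.laplacian v x = 1 / v x
  stable : ∀ ζ : EuclideanSpace ℝ (Fin n) → ℝ, ContDiff ℝ 1 ζ → HasCompactSupport ζ →
    tsupport ζ ⊆ W → ∫ x, ζ x ^ 2 / v x ^ 2 ≤ ∫ x, ‖∇ ζ x‖ ^ 2

/-! ### Green's identity, mollified test functions and localization -/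

section Calculus

variable {n : ℕ}

local notation "𝔼" => EuclideanSpace ℝ (Fin n)

theorem norm_gradient_eq (f : 𝔼 → ℝ) (x : 𝔼) : ‖∇ f x‖ = ‖fderiv ℝ f x‖ := by
  simp [gradient]

theorem ContDiff.continuous_gradient {f : 𝔼 → ℝ} (hf : ContDiff ℝ 1 f) : Continuous (∇ f) :=
  (InnerProductSpace.toDual ℝ 𝔼).symm.continuous.comp (hf.continuous_fderiv one_ne_zero)

theorem gradient_eq_zero_of_notMem_tsupport {f : 𝔼 → ℝ} {x : 𝔼} (hx : x ∉ tsupport f) :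
    ∇ f x = 0 := by
  have : fderiv ℝ f x = 0 := image_eq_zero_of_notMem_tsupport
    (fun h => hx (tsupport_fderiv_subset ℝ h))
  simp [gradient, this]

/-- Green's identity for a `C²` function composed with a dilation and a compactly supported
test function. -/
theorem integral_mul_laplacian_comp {v g : 𝔼 → ℝ} (hv : ContDiff ℝ 2 v) (hg : ContDiff ℝ 1 g)
    (hgc : HasCompactSupport g) (x : 𝔼) (s : ℝ) :
    s * ∫ y, g y * Laplacian.laplacian v (x + s • y) =
      -∫ y, inner ℝ (∇ v (x + s • y)) (∇ g y) := by
  let b := EuclideanSpace.basisFun (Fin n) ℝ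
  have hDv : ContDiff ℝ 1 (fderiv ℝ v) := hv.fderiv_right (by norm_num)
  have hgd : Differentiable ℝ g := hg.differentiable one_ne_zero
  have hDg : Continuous (fderiv ℝ g) := hg.continuous_fderiv one_ne_zero
  have hA : ContDiff ℝ 1 (fun y : 𝔼 => x + s • y) := by fun_prop
  let h : Fin n → 𝔼 → ℝ := fun i y => fderiv ℝ v (x + s • y) (b i)
  have hh : ∀ i, ContDiff ℝ 1 (h i) := fun i => (hDv.comp hA).clm_apply contDiff_const
  -- The dilation contributes one factor `s` by the chain rule, which is the factor on the left of
  -- Green's identity.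
  have hfd : ∀ i y, fderiv ℝ (h i) y (b i) =
      s * iteratedFDeriv ℝ 2 v (x + s • y) ![b i, b i] := by
    intro i y
    have h1 : HasFDerivAt (fun y : 𝔼 => x + s • y) (s • ContinuousLinearMap.id ℝ 𝔼) y :=
      ((hasFDerivAt_id y).const_smul s).const_add x
    have h2 := (hDv.differentiable one_ne_zero (x + s • y)).hasFDerivAt.comp y h1
    have h3 := (h2.clm_apply (hasFDerivAt_const (b i) y)).fderiv
    rw [iteratedFDeriv_two_apply]
    have h4 : fderiv ℝ (h i) y = _ := h3
    rw [h4]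
    simp
  have hint : ∀ i, ∫ y, g y * fderiv ℝ (h i) y (b i) = -∫ y, fderiv ℝ g y (b i) * h i y := by
    intro i
    have hc1 : Continuous (fun y => fderiv ℝ (h i) y (b i)) :=
      ((hh i).continuous_fderiv one_ne_zero).clm_apply continuous_const
    have hc2 : Continuous (fun y => fderiv ℝ g y (b i)) := hDg.clm_apply continuous_const
    refine integral_mul_fderiv_eq_neg_fderiv_mul_of_integrable ?_ ?_ ?_
      (fun y _ => hgd y) (fun y _ => (hh i).differentiable one_ne_zero y)
    · exact (hc2.mul (hh i).continuous).integrable_of_hasCompactSupport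
        (hgc.fderiv_apply ℝ (b i)).mul_right
    · exact (hg.continuous.mul hc1).integrable_of_hasCompactSupport hgc.mul_right
    · exact (hg.continuous.mul (hh i).continuous).integrable_of_hasCompactSupport hgc.mul_right
  have hl : ∀ y, s * (g y * Laplacian.laplacian v (x + s • y)) =
      ∑ i, g y * fderiv ℝ (h i) y (b i) := by
    intro y
    rw [InnerProductSpace.laplacian_eq_iteratedFDeriv_orthonormalBasis v b]
    simp only [hfd, Finset.mul_sum]
    exact Finset.sum_congr rfl fun i _ => by ring
  have hr : ∀ y, inner ℝ (∇ v (x + s • y)) (∇ g y) = ∑ i, fderiv ℝ g y (b i) * h i y := by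
    intro y
    rw [← b.sum_inner_mul_inner]
    refine Finset.sum_congr rfl fun i _ => ?_
    rw [inner_gradient_left, real_inner_comm, inner_gradient_left, mul_comm]
  rw [← integral_const_mul]
  simp_rw [hl, hr]
  rw [integral_finsetSum, integral_finsetSum, ← Finset.sum_neg_distrib]
  · exact Finset.sum_congr rfl fun i _ => hint i
  · intro i _
    exact ((hDg.clm_apply continuous_const).mul (hh i).continuous).integrable_of_hasCompactSupport
      (hgc.fderiv_apply ℝ (b i)).mul_right
  · intro i _
    exact (hg.continuous.mul (((hh i).continuous_fderiv one_ne_zero).clm_apply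
      continuous_const)).integrable_of_hasCompactSupport hgc.mul_right

/-- An integral inequality of stability type extends from smooth to `C¹` test functions. -/
theorem stability_of_contDiff_one {v ζ : 𝔼 → ℝ} {W : Set 𝔼} (hW : IsOpen W) (hv : Continuous v)
    (hpos : ∀ x, 0 < v x)
    (hst : ∀ ζ : 𝔼 → ℝ, IsTestFunction W ζ → ∫ x, ζ x ^ 2 / v x ^ 2 ≤ ∫ x, ‖∇ ζ x‖ ^ 2)
    (hζ : ContDiff ℝ 1 ζ) (hc : HasCompactSupport ζ) (hs : tsupport ζ ⊆ W) :
    ∫ x, ζ x ^ 2 / v x ^ 2 ≤ ∫ x, ‖∇ ζ x‖ ^ 2 := by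
  obtain ⟨δ, hδ, hδW⟩ := hc.isCompact.exists_cthickening_subset_open hW hs
  let K := Metric.cthickening δ (tsupport ζ)
  have hK : IsCompact K := hc.isCompact.cthickening
  have hrpos : ∀ k : ℕ, 0 < δ / (k + 1) := fun k => by positivity
  -- Mollification radii at most `δ` keep every mollified function supported in the fixed compact
  -- set `K`, inside `W`.
  let φ : ℕ → ContDiffBump (0 : 𝔼) := fun k =>
    ⟨δ / (k + 1) / 2, δ / (k + 1), half_pos (hrpos k), half_lt_self (hrpos k)⟩
  have hφ : Tendsto (fun k => (φ k).rOut) atTop (𝓝 0) := by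
    simpa [φ, div_eq_mul_inv] using
      (tendsto_one_div_add_atTop_nhds_zero_nat (𝕜 := ℝ)).const_mul δ
  let Z : ℕ → 𝔼 → ℝ := fun k =>
    ((φ k).normed volume ⋆[ContinuousLinearMap.lsmul ℝ ℝ, volume] ζ : 𝔼 → ℝ)
  have hloc : ∀ k, LocallyIntegrable ((φ k).normed volume) (volume : Measure 𝔼) := fun k =>
    (φ k).continuous_normed.locallyIntegrable
  have hZsmooth : ∀ k, ContDiff ℝ ∞ (Z k) := fun k =>
    (φ k).hasCompactSupport_normed.contDiff_convolution_left _ (φ k).contDiff_normed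
      hζ.continuous.locallyIntegrable
  have hZfd : ∀ k x, fderiv ℝ (Z k) x =
      ((φ k).normed volume ⋆[ContinuousLinearMap.lsmul ℝ ℝ, volume] fderiv ℝ ζ : 𝔼 → _) x := by
    intro k x
    exact (hc.hasFDerivAt_convolution_right (ContinuousLinearMap.lsmul ℝ ℝ) (hloc k) hζ x).fderiv
  have hZsupp : ∀ k, tsupport (Z k) ⊆ K := by
    intro k
    refine closure_minimal ?_ Metric.isClosed_cthickening
    intro x hx
    by_contra hxK
    refine hx ?_
    have hz : ∀ y ∈ Metric.ball x (φ k).rOut, ζ y = 0 := by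
      intro y hy
      refine image_eq_zero_of_notMem_tsupport fun hyt => hxK ?_
      refine Metric.mem_cthickening_of_dist_le x y δ _ hyt ?_
      have h1 : (φ k).rOut ≤ δ := div_le_self hδ.le (by simp)
      rw [dist_comm]
      exact (Metric.mem_ball.1 hy).le.trans h1
    have hx0 := hz x (Metric.mem_ball_self (φ k).rOut_pos)
    have := (φ k).normed_convolution_eq_right (μ := volume) (g := ζ) (x₀ := x)
      (fun y hy => by rw [hz y hy, hx0])
    exact this.trans hx0
  have hZtest : ∀ k, IsTestFunction W (Z k) := fun k =>
    ⟨hZsmooth k, HasCompactSupport.of_support_subset_isCompact hK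
      (subset_closure.trans (hZsupp k)), (hZsupp k).trans hδW⟩
  -- A mollification differs from `f` by at most `2 * B` when `‖f‖ ≤ B`. The bound is uniform in `k`
  -- and supplies dominating functions for `ζ` and its derivative.
  have hconv : ∀ {F : Type} [NormedAddCommGroup F] [NormedSpace ℝ F] [CompleteSpace F]
      (f : 𝔼 → F), Continuous f → HasCompactSupport f → ∃ B, ∀ k x,
      ‖((φ k).normed volume ⋆[ContinuousLinearMap.lsmul ℝ ℝ, volume] f : 𝔼 → F) x‖ ≤ B := by
    intro F _ _ _ f hf hfc
    obtain ⟨B, hB⟩ := hfc.exists_bound_of_continuous hf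
    refine ⟨2 * B + B, fun k x => ?_⟩
    have h1 := (φ k).dist_normed_convolution_le (μ := volume) (g := f) (x₀ := x) (ε := 2 * B)
      hf.aestronglyMeasurable (fun y _ => by
        rw [dist_eq_norm]
        linarith [norm_sub_le (f y) (f x), hB y, hB x])
    rw [dist_eq_norm] at h1
    linarith [norm_le_norm_sub_add (((φ k).normed volume
      ⋆[ContinuousLinearMap.lsmul ℝ ℝ, volume] f : 𝔼 → F) x) (f x), hB x]
  obtain ⟨B, hB⟩ := hconv ζ hζ.continuous hc
  obtain ⟨B', hB'⟩ := hconv (fderiv ℝ ζ) (hζ.continuous_fderiv one_ne_zero) (hc.fderiv ℝ)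
  obtain ⟨M, hM⟩ := hK.exists_bound_of_continuousOn (f := fun x => (v x ^ 2)⁻¹)
    ((hv.pow 2).inv₀ fun x => (pow_pos (hpos x) 2).ne').continuousOn
  have hintK : ∀ c : ℝ, Integrable (K.indicator fun _ => c) (volume : Measure 𝔼) := fun c =>
    (integrable_indicator_iff hK.measurableSet).2 (integrableOn_const hK.measure_lt_top.ne)
  have hL : Tendsto (fun k => ∫ x, Z k x ^ 2 / v x ^ 2) atTop (𝓝 (∫ x, ζ x ^ 2 / v x ^ 2)) := by
    refine tendsto_integral_of_dominated_convergence (K.indicator fun _ => B ^ 2 * M) ?_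
      (hintK _) ?_ ?_
    · intro k
      exact (((hZsmooth k).continuous.pow 2).div (hv.pow 2)
        fun x => (pow_pos (hpos x) 2).ne').aestronglyMeasurable
    · intro k
      refine ae_of_all _ fun x => ?_
      by_cases hx : x ∈ K
      · rw [indicator_of_mem hx, div_eq_mul_inv, norm_mul, norm_pow]
        have := hM x hx
        have := hB k x
        gcongr
      · rw [indicator_of_notMem hx, image_eq_zero_of_notMem_tsupport fun h => hx (hZsupp k h)]
        simp
    · refine ae_of_all _ fun x => ?_
      exact ((ContDiffBump.convolution_tendsto_right_of_continuous hφ hζ.continuous x).pow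
        2).div_const _
  have hR : Tendsto (fun k => ∫ x, ‖∇ (Z k) x‖ ^ 2) atTop (𝓝 (∫ x, ‖∇ ζ x‖ ^ 2)) := by
    simp only [norm_gradient_eq]
    refine tendsto_integral_of_dominated_convergence (K.indicator fun _ => B' ^ 2) ?_
      (hintK _) ?_ ?_
    · intro k
      exact ((((hZsmooth k).of_le (m := 1) (by simp)).continuous_fderiv
        one_ne_zero).norm.pow 2).aestronglyMeasurable
    · intro k
      refine ae_of_all _ fun x => ?_
      by_cases hx : x ∈ K
      · rw [indicator_of_mem hx, norm_pow, norm_norm, hZfd]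
        have := hB' k x
        gcongr
      · rw [indicator_of_notMem hx, image_eq_zero_of_notMem_tsupport
          fun h => hx (hZsupp k (tsupport_fderiv_subset ℝ h))]
        simp
    · refine ae_of_all _ fun x => ?_
      simp only [hZfd]
      exact ((ContDiffBump.convolution_tendsto_right_of_continuous hφ
        (hζ.continuous_fderiv one_ne_zero) x).norm.pow 2)
  exact le_of_tendsto_of_tendsto' hL hR fun k => hst (Z k) (hZtest k)

/-- Near each point a stable solution agrees with a globally defined one. -/
theorem IsPositiveSolution.exists_isStableSolutionOn {Ω : Set 𝔼} {u : 𝔼 → ℝ} (hΩ : IsOpen Ω)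
    (hu : IsPositiveSolution Ω u) (hst : IsStable Ω u) {x₀ : 𝔼} {R : ℝ} (hR : 0 < R)
    (hsub : Metric.closedBall x₀ (2 * R) ⊆ Ω) :
    ∃ v, IsStableSolutionOn (Metric.ball x₀ R) v ∧ EqOn v u (Metric.ball x₀ R) := by
  let χ : ContDiffBump x₀ := ⟨R, 2 * R, hR, by linarith⟩
  -- A convex combination with the constant `1` stays positive where `u` is positive, and is `1`
  -- where nothing is known about `u`.
  let v : 𝔼 → ℝ := fun x => χ x * u x + (1 - χ x)
  have hts : tsupport χ ⊆ Ω := χ.tsupport_eq.subset.trans hsub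
  have hvu : EqOn v u (Metric.ball x₀ R) := fun x hx => by
    simp [v, χ.one_of_mem_closedBall (Metric.ball_subset_closedBall hx)]
  have hcd : ContDiff ℝ 2 v := by
    rw [contDiff_iff_contDiffAt]
    intro x
    by_cases hx : x ∈ tsupport χ
    · have h1 : ContDiffAt ℝ 2 u x := hu.contDiffOn.contDiffAt (hΩ.mem_nhds (hts hx))
      exact (χ.contDiffAt.mul h1).add (contDiffAt_const.sub χ.contDiffAt)
    · have h1 : v =ᶠ[𝓝 x] fun _ => 1 := by
        filter_upwards [(isClosed_tsupport χ).isOpen_compl.mem_nhds hx] with y hy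
        simp [v, image_eq_zero_of_notMem_tsupport hy]
      exact contDiffAt_const.congr_of_eventuallyEq h1
  have hpos : ∀ x, 0 < v x := by
    intro x
    by_cases hx : x ∈ tsupport χ
    · have h1 := hu.pos x (hts hx)
      rcases χ.nonneg.eq_or_lt (a := 0) (b := χ x) with h | h
      · simp [v, ← h]
      · have : 0 ≤ 1 - χ x := sub_nonneg.2 χ.le_one
        positivity
    · simp [v, image_eq_zero_of_notMem_tsupport hx]
  refine ⟨v, ⟨hcd, hpos, ?_, ?_⟩, hvu⟩
  · intro x hx
    have h1 : v =ᶠ[𝓝 x] u := hvu.eventuallyEq_of_mem (Metric.isOpen_ball.mem_nhds hx)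
    have hxΩ : x ∈ Ω := hsub (Metric.closedBall_subset_closedBall (by linarith)
      (Metric.ball_subset_closedBall hx))
    rw [(InnerProductSpace.laplacian_congr_nhds h1).eq_of_nhds, hu.laplacian_eq x hxΩ, hvu hx]
  · intro ζ hζ hc hs
    refine stability_of_contDiff_one Metric.isOpen_ball hcd.continuous hpos ?_ hζ hc hs
    intro ζ hζ
    have hbΩ : Metric.ball x₀ R ⊆ Ω := Metric.ball_subset_closedBall.trans
      ((Metric.closedBall_subset_closedBall (by linarith)).trans hsub)
    have hζΩ : IsTestFunction Ω ζ :=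
      ⟨hζ.contDiff, hζ.hasCompactSupport, hζ.tsupport_subset.trans hbΩ⟩
    have h1 := hst ζ hζΩ
    rw [setIntegral_eq_integral_of_forall_compl_eq_zero,
      setIntegral_eq_integral_of_forall_compl_eq_zero] at h1
    · simp only [norm_gradient_eq]
      convert h1 using 3 with x
      by_cases hx : x ∈ Metric.ball x₀ R
      · rw [hvu hx]
      · rw [image_eq_zero_of_notMem_tsupport fun h => hx (hζ.tsupport_subset h)]
        simp
    · intro x hx
      rw [image_eq_zero_of_notMem_tsupport
        fun h => hx (hζΩ.tsupport_subset (tsupport_fderiv_subset ℝ h))]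
      simp
    · intro x hx
      rw [image_eq_zero_of_notMem_tsupport fun h => hx (hζΩ.tsupport_subset h)]
      simp

end Calculus

/-! ### The weighted integral inequality from stability -/

section Estimates

variable {n : ℕ}

local notation "𝔼" => EuclideanSpace ℝ (Fin n)

theorem HasGradientAt.mul {f g : 𝔼 → ℝ} {f' g' x : 𝔼} (hf : HasGradientAt f f' x)
    (hg : HasGradientAt g g' x) :
    HasGradientAt (fun y => f y * g y) (f x • g' + g x • f') x := by
  rw [hasGradientAt_iff_hasFDerivAt] at *
  have e : InnerProductSpace.toDual ℝ 𝔼 (f x • g' + g x • f') =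
      f x • InnerProductSpace.toDual ℝ 𝔼 g' + g x • InnerProductSpace.toDual ℝ 𝔼 f' := by simp
  rw [e]
  exact HasFDerivAt.mul hf hg

theorem HasDerivAt.comp_hasGradientAt {F : ℝ → ℝ} {F' : ℝ} {f : 𝔼 → ℝ} {f' x : 𝔼}
    (hF : HasDerivAt F F' (f x)) (hf : HasGradientAt f f' x) :
    HasGradientAt (fun y => F (f y)) (F' • f') x := by
  rw [hasGradientAt_iff_hasFDerivAt] at *
  have e : InnerProductSpace.toDual ℝ 𝔼 (F' • f') = F' • InnerProductSpace.toDual ℝ 𝔼 f' := by simp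
  rw [e]
  exact hF.comp_hasFDerivAt x hf

theorem ContDiff.hasGradientAt {f : 𝔼 → ℝ} (hf : ContDiff ℝ 1 f) (x : 𝔼) :
    HasGradientAt f (∇ f x) x :=
  (hf.differentiable one_ne_zero x).hasGradientAt

/-- If the integral of `‖w - a p‖²` controls that of `(2a+1)‖p‖² - 2⟨p, w⟩` then so does
a multiple of the integral of `‖w‖²`. -/
theorem exists_integral_sq_le_of_stability {a : ℝ} (ha : a ^ 2 < 2 * a + 1) :
    ∃ C : ℝ, 0 < C ∧ ∀ (I : ℝ) (p w : 𝔼 → 𝔼),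
      Integrable (fun x => ‖p x‖ ^ 2) → Integrable (fun x => ‖w x‖ ^ 2) →
      Integrable (fun x => (inner ℝ (p x) (w x) : ℝ)) →
      I ≤ ∫ x, ‖w x - a • p x‖ ^ 2 →
      I = ∫ x, ((2 * a + 1) * ‖p x‖ ^ 2 - 2 * inner ℝ (p x) (w x)) →
      I ≤ C * ∫ x, ‖w x‖ ^ 2 := by
  have hδ : 0 < 2 * a + 1 - a ^ 2 := by linarith
  -- This `t` makes the coefficient of `‖p‖²` in `(1 + t) * (stability) - t * (equation)` equal to
  -- `-1`; completing the square then removes `p`.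
  set t := (a ^ 2 + 1) / (2 * a + 1 - a ^ 2) with ht
  have ht0 : 0 ≤ t := by positivity
  have htδ : t * (2 * a + 1 - a ^ 2) = a ^ 2 + 1 := div_mul_cancel₀ _ hδ.ne'
  refine ⟨(t - a * (1 + t)) ^ 2 + 1 + t, by positivity, ?_⟩
  intro I p w hp hw hpw h1 h2
  have e1 : ∀ x, ‖w x - a • p x‖ ^ 2 =
      ‖w x‖ ^ 2 - 2 * a * inner ℝ (p x) (w x) + a ^ 2 * ‖p x‖ ^ 2 := by
    intro x
    rw [norm_sub_sq_real, inner_smul_right, real_inner_comm, norm_smul, mul_pow,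
      Real.norm_eq_abs, sq_abs]
    ring
  simp only [e1] at h1
  have i1 : Integrable fun x =>
      ‖w x‖ ^ 2 - 2 * a * inner ℝ (p x) (w x) + a ^ 2 * ‖p x‖ ^ 2 :=
    (hw.sub (hpw.const_mul _)).add (hp.const_mul _)
  have i2 : Integrable fun x => (2 * a + 1) * ‖p x‖ ^ 2 - 2 * inner ℝ (p x) (w x) :=
    (hp.const_mul _).sub (hpw.const_mul _)
  calc I = (1 + t) * I - t * I := by ring
    _ ≤ (1 + t) * (∫ x, (‖w x‖ ^ 2 - 2 * a * inner ℝ (p x) (w x) + a ^ 2 * ‖p x‖ ^ 2))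
        - t * ∫ x, ((2 * a + 1) * ‖p x‖ ^ 2 - 2 * inner ℝ (p x) (w x)) := by
      rw [← h2]
      gcongr
    _ = ∫ x, ((1 + t) * (‖w x‖ ^ 2 - 2 * a * inner ℝ (p x) (w x) + a ^ 2 * ‖p x‖ ^ 2)
        - t * ((2 * a + 1) * ‖p x‖ ^ 2 - 2 * inner ℝ (p x) (w x))) := by
      rw [integral_sub (i1.const_mul _) (i2.const_mul _), integral_const_mul, integral_const_mul]
    _ ≤ ∫ x, ((t - a * (1 + t)) ^ 2 + 1 + t) * ‖w x‖ ^ 2 := by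
      refine integral_mono ((i1.const_mul _).sub (i2.const_mul _)) (hw.const_mul _) fun x => ?_
      have h3 := sq_nonneg ‖p x - (t - a * (1 + t)) • w x‖
      have h4 : ‖p x - (t - a * (1 + t)) • w x‖ ^ 2 = ‖p x‖ ^ 2
          - 2 * (t - a * (1 + t)) * inner ℝ (p x) (w x) + (t - a * (1 + t)) ^ 2 * ‖w x‖ ^ 2 := by
        rw [norm_sub_sq_real, inner_smul_right, norm_smul, mul_pow, Real.norm_eq_abs, sq_abs]
        ring
      have h5 : (1 + t) * (‖w x‖ ^ 2 - 2 * a * inner ℝ (p x) (w x) + a ^ 2 * ‖p x‖ ^ 2)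
          - t * ((2 * a + 1) * ‖p x‖ ^ 2 - 2 * inner ℝ (p x) (w x)) =
          ((t - a * (1 + t)) ^ 2 + 1 + t) * ‖w x‖ ^ 2
          - ‖p x - (t - a * (1 + t)) • w x‖ ^ 2 := by
        rw [h4]
        linear_combination -‖p x‖ ^ 2 * htδ
      simp only [h5]
      linarith
    _ = _ := integral_const_mul _ _

/-- Put `p = v ^ (-a-1) φ ∇v` and `w = v ^ (-a) ∇φ`. The gradient of `v ^ (-a) φ` is `w - a p`, so
stability gives the upper bound by `∫ ‖w - a p‖²`. Testing the equation with `v ^ (-(2a+1)) φ²`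
expresses the same integral as `∫ ((2a+1) ‖p‖² - 2 ⟨p, w⟩)`. -/
theorem exists_integral_rpow_mul_sq_le {a : ℝ} (ha : a ^ 2 < 2 * a + 1) :
    ∃ C : ℝ, 0 < C ∧ ∀ {W : Set 𝔼} {v φ : 𝔼 → ℝ}, IsStableSolutionOn W v →
      ContDiff ℝ 1 φ → HasCompactSupport φ → tsupport φ ⊆ W →
      ∫ x, v x ^ (-(2 * a + 2)) * φ x ^ 2 ≤ C * ∫ x, v x ^ (-(2 * a)) * ‖∇ φ x‖ ^ 2 := by
  obtain ⟨C, hC, hmain⟩ := exists_integral_sq_le_of_stability (n := n) ha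
  refine ⟨C, hC, ?_⟩
  intro W v φ hv hφ hc hs
  have hv1 : ContDiff ℝ 1 v := hv.contDiff.of_le (by norm_num)
  have hvne : ∀ x, v x ≠ 0 := fun x => (hv.pos x).ne'
  have hpow : ∀ b : ℝ, ContDiff ℝ 1 fun x => v x ^ b := fun b => hv1.rpow_const_of_ne hvne
  have hgrad : ∀ (b : ℝ) x, HasGradientAt (fun x => v x ^ b) ((b * v x ^ (b - 1)) • ∇ v x) x :=
    fun b x => (Real.hasDerivAt_rpow_const (Or.inl (hvne x))).comp_hasGradientAt (hv1.hasGradientAt x)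
  let p : 𝔼 → 𝔼 := fun x => (v x ^ (-a - 1) * φ x) • ∇ v x
  let w : 𝔼 → 𝔼 := fun x => v x ^ (-a) • ∇ φ x
  have hpc : Continuous p :=
    ((hpow _).continuous.mul hφ.continuous).smul hv1.continuous_gradient
  have hwc : Continuous w := (hpow _).continuous.smul hφ.continuous_gradient
  have hp0 : ∀ x ∉ tsupport φ, p x = 0 := fun x hx => by
    simp [p, image_eq_zero_of_notMem_tsupport hx]
  have hw0 : ∀ x ∉ tsupport φ, w x = 0 := fun x hx => by
    simp [w, gradient_eq_zero_of_notMem_tsupport hx]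
  have hsupp : ∀ {f : 𝔼 → ℝ}, (∀ x, φ x = 0 → f x = 0) →
      HasCompactSupport f ∧ tsupport f ⊆ W := fun {f} h => by
    have h1 : Function.support f ⊆ Function.support φ := fun x hx hx0 => hx (h x hx0)
    exact ⟨hc.mono h1, (closure_mono h1).trans hs⟩
  have hpi : Integrable fun x => ‖p x‖ ^ 2 :=
    Continuous.integrable_of_hasCompactSupport (hpc.norm.pow 2)
      (HasCompactSupport.intro hc.isCompact fun x hx => by simp [hp0 x hx])
  have hwi : Integrable fun x => ‖w x‖ ^ 2 :=
    Continuous.integrable_of_hasCompactSupport (hwc.norm.pow 2)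
      (HasCompactSupport.intro hc.isCompact fun x hx => by simp [hw0 x hx])
  have hpwi : Integrable fun x => (inner ℝ (p x) (w x) : ℝ) :=
    Continuous.integrable_of_hasCompactSupport (hpc.inner hwc)
      (HasCompactSupport.intro hc.isCompact fun x hx => by simp [hp0 x hx])
  have hI1 : ∫ x, v x ^ (-(2 * a + 2)) * φ x ^ 2 ≤ ∫ x, ‖w x - a • p x‖ ^ 2 := by
    have h1 := hv.stable (fun x => v x ^ (-a) * φ x) ((hpow _).mul hφ)
      (hsupp fun x hx => by simp [hx]).1 (hsupp fun x hx => by simp [hx]).2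
    have e1 : ∀ x, (v x ^ (-a) * φ x) ^ 2 / v x ^ 2 = v x ^ (-(2 * a + 2)) * φ x ^ 2 := by
      intro x
      rw [mul_pow, ← Real.rpow_mul_natCast (hv.pos x).le, show -(2 * a + 2) = -a * (2 : ℕ) - (2 : ℕ)
        by push_cast; ring, Real.rpow_sub_natCast (hvne x)]
      ring
    have e2 : ∀ x, ∇ (fun x => v x ^ (-a) * φ x) x = w x - a • p x := by
      intro x
      rw [((hgrad (-a) x).mul (hφ.hasGradientAt x)).gradient]
      simp only [w, p]
      module
    simpa only [e1, e2] using h1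
  have hI2 : ∫ x, v x ^ (-(2 * a + 2)) * φ x ^ 2 =
      ∫ x, ((2 * a + 1) * ‖p x‖ ^ 2 - 2 * inner ℝ (p x) (w x)) := by
    have hg : ContDiff ℝ 1 fun x => v x ^ (-(2 * a + 1)) * φ x ^ 2 := (hpow _).mul (hφ.pow 2)
    have hgs := hsupp (f := fun x => v x ^ (-(2 * a + 1)) * φ x ^ 2) fun x hx => by simp [hx]
    have h1 := integral_mul_laplacian_comp hv.contDiff hg hgs.1 0 1
    simp only [zero_add, one_smul, one_mul] at h1
    have e1 : ∀ x, v x ^ (-(2 * a + 1)) * φ x ^ 2 * Laplacian.laplacian v x =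
        v x ^ (-(2 * a + 2)) * φ x ^ 2 := by
      intro x
      by_cases hx : x ∈ W
      · rw [hv.laplacian_eq x hx, show -(2 * a + 2) = -(2 * a + 1) - 1 by ring,
          Real.rpow_sub_one (hvne x)]
        ring
      · rw [image_eq_zero_of_notMem_tsupport fun h => hx (hs h)]
        simp
    have e2 : ∀ x, inner ℝ (∇ v x) (∇ (fun x => v x ^ (-(2 * a + 1)) * φ x ^ 2) x) =
        -((2 * a + 1) * ‖p x‖ ^ 2 - 2 * inner ℝ (p x) (w x)) := by
      intro x
      have h2 : HasGradientAt (fun x => φ x ^ 2) ((2 * φ x) • ∇ φ x) x := by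
        simpa using (hasDerivAt_pow 2 (φ x)).comp_hasGradientAt (hφ.hasGradientAt x)
      have r1 : v x ^ (-(2 * a + 1) - 1) = v x ^ (-a - 1) * v x ^ (-a - 1) := by
        rw [← Real.rpow_add (hv.pos x)]; ring_nf
      have r2 : v x ^ (-(2 * a + 1)) = v x ^ (-a - 1) * v x ^ (-a) := by
        rw [← Real.rpow_add (hv.pos x)]; ring_nf
      rw [((hgrad _ x).mul h2).gradient]
      simp only [p, w, inner_add_right, inner_smul_right, inner_smul_left, norm_smul,
        real_inner_self_eq_norm_sq, mul_pow, Real.norm_eq_abs, sq_abs, abs_mul, r1, r2]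
      simp
      ring
    simp only [e1, e2] at h1
    rw [h1, integral_neg, neg_neg]
  refine (hmain _ p w hpi hwi hpwi hI1 hI2).trans_eq ?_
  congr 1
  refine integral_congr_ae (ae_of_all _ fun x => ?_)
  have r1 : v x ^ (-(2 * a)) = v x ^ (-a) * v x ^ (-a) := by
    rw [← Real.rpow_add (hv.pos x)]; ring_nf
  simp only [w]
  rw [norm_smul, mul_pow, Real.norm_eq_abs, sq_abs, r1, sq (v x ^ (-a))]

end Estimates

/-! ### Cutoff functions and the interior estimate -/

theorem hasDerivAt_max_zero_pow_four (t : ℝ) :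
    HasDerivAt (fun t : ℝ => max 0 t ^ 4) (4 * max 0 t ^ 3) t := by
  rcases lt_trichotomy t 0 with h | rfl | h
  · have h1 : (fun t : ℝ => max 0 t ^ 4) =ᶠ[𝓝 t] fun _ => 0 := by
      filter_upwards [gt_mem_nhds h] with s hs
      simp [max_eq_left hs.le]
    simpa [max_eq_left h.le] using (hasDerivAt_const t (0 : ℝ)).congr_of_eventuallyEq h1
  · have h1 : (fun t : ℝ => max 0 t ^ 4) =O[𝓝 0] fun t => ‖t - 0‖ ^ 4 := by
      refine Asymptotics.IsBigO.of_bound 1 (Eventually.of_forall fun t => ?_)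
      simp only [sub_zero, norm_pow, norm_norm, one_mul]
      gcongr
      rw [Real.norm_of_nonneg (le_max_left _ _), Real.norm_eq_abs]
      exact max_le (abs_nonneg _) (le_abs_self _)
    simpa using (h1.hasFDerivAt (by norm_num)).hasDerivAt
  · have h1 : (fun t : ℝ => max 0 t ^ 4) =ᶠ[𝓝 t] fun t => t ^ 4 := by
      filter_upwards [lt_mem_nhds h] with s hs
      simp [max_eq_right hs.le]
    simpa [max_eq_right h.le] using (hasDerivAt_pow 4 t).congr_of_eventuallyEq h1

section Cutoff

variable {n : ℕ}

local notation "𝔼" => EuclideanSpace ℝ (Fin n)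

/-- The truncated paraboloid `(1 - |y|²)₊`, vanishing outside the unit ball. -/
noncomputable def truncParaboloid (y : 𝔼) : ℝ := max 0 (1 - ‖y‖ ^ 2)

theorem truncParaboloid_nonneg (y : 𝔼) : 0 ≤ truncParaboloid y := le_max_left _ _

theorem truncParaboloid_le_one (y : 𝔼) : truncParaboloid y ≤ 1 :=
  max_le zero_le_one (by linarith [sq_nonneg ‖y‖])

theorem truncParaboloid_eq_zero {y : 𝔼} (hy : 1 ≤ ‖y‖) : truncParaboloid y = 0 :=
  max_eq_left (by nlinarith)

theorem le_truncParaboloid {y : 𝔼} (hy : ‖y‖ ≤ 1 / 2) : 3 / 4 ≤ truncParaboloid y :=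
  le_max_of_le_right (by nlinarith [norm_nonneg y])

theorem continuous_truncParaboloid : Continuous (truncParaboloid : 𝔼 → ℝ) := by
  unfold truncParaboloid
  fun_prop

theorem hasGradientAt_truncParaboloid_pow_four (y : 𝔼) :
    HasGradientAt (fun y => truncParaboloid y ^ 4) ((-8 * truncParaboloid y ^ 3) • y) y := by
  have h1 : HasGradientAt (fun y : 𝔼 => 1 - ‖y‖ ^ 2) (-(2 : ℝ) • y) y := by
    rw [hasGradientAt_iff_hasFDerivAt]
    have h2 := ((hasStrictFDerivAt_norm_sq y).hasFDerivAt).const_sub (1 : ℝ)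
    have e : InnerProductSpace.toDual ℝ 𝔼 (-(2 : ℝ) • y) = -((2 : ℕ) • innerSL ℝ y) := by
      ext z
      simp [two_mul]
    rw [e]
    exact h2
  have h3 := (hasDerivAt_max_zero_pow_four (1 - ‖y‖ ^ 2)).comp_hasGradientAt
    (f := fun y : 𝔼 => 1 - ‖y‖ ^ 2) h1
  have e : (-8 * truncParaboloid y ^ 3) • y =
      (4 * max 0 (1 - ‖y‖ ^ 2) ^ 3) • (-(2 : ℝ) • y) := by
    rw [smul_smul, truncParaboloid]
    ring_nf
  rw [e]
  exact h3

theorem contDiff_truncParaboloid_pow_four :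
    ContDiff ℝ 1 (fun y : 𝔼 => truncParaboloid y ^ 4) := by
  have h1 : ContDiff ℝ 1 (fun t : ℝ => max 0 t ^ 4) := by
    rw [contDiff_one_iff_deriv]
    refine ⟨fun t => (hasDerivAt_max_zero_pow_four t).differentiableAt, ?_⟩
    have h2 : deriv (fun t : ℝ => max 0 t ^ 4) = fun t => 4 * max 0 t ^ 3 :=
      funext fun t => (hasDerivAt_max_zero_pow_four t).deriv
    rw [h2]
    fun_prop
  exact h1.comp (contDiff_const.sub (contDiff_norm_sq ℝ))

theorem HasGradientAt.comp_smul_sub {f : 𝔼 → ℝ} {f' x z : 𝔼} {c : ℝ}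
    (hf : HasGradientAt f f' (c • (z - x))) :
    HasGradientAt (fun z => f (c • (z - x))) (c • f') z := by
  rw [hasGradientAt_iff_hasFDerivAt] at *
  have h1 : HasFDerivAt (fun z : 𝔼 => c • (z - x)) (c • ContinuousLinearMap.id ℝ 𝔼) z :=
    ((hasFDerivAt_id z).sub_const x).const_smul c
  have e : InnerProductSpace.toDual ℝ 𝔼 (c • f') =
      (InnerProductSpace.toDual ℝ 𝔼 f').comp (c • ContinuousLinearMap.id ℝ 𝔼) := by
    ext y
    simp
  rw [e]
  exact HasFDerivAt.comp z hf h1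

/-- A Young-type inequality, by cases on `V ≤ δ R p`. The powers 6 and 8 come from `|∇P⁴|²` and
`(P⁴)²`; `a ≤ 3` ensures `p ^ (6 - 2a) ≤ 1`. -/
theorem rpow_mul_pow_six_div_sq_le {a V p R δ : ℝ} (ha : 0 < a) (ha3 : a ≤ 3) (hV : 0 < V)
    (hp0 : 0 ≤ p) (hp1 : p ≤ 1) (hR : 0 < R) (hδ : 0 < δ) :
    V ^ (-(2 * a)) * (p ^ 6 / R ^ 2) ≤
      δ ^ 2 * (V ^ (-(2 * a + 2)) * p ^ 8) + δ ^ (-(2 * a)) * R ^ (-(2 * a + 2)) := by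
  have hpos2 : 0 ≤ δ ^ (-(2 * a)) * R ^ (-(2 * a + 2)) := by positivity
  have hpos1 : 0 ≤ δ ^ 2 * (V ^ (-(2 * a + 2)) * p ^ 8) := by positivity
  rcases hp0.eq_or_lt with rfl | hp
  · simp at *
    linarith
  rcases le_or_gt V (δ * R * p) with h | h
  · refine le_trans ?_ (le_add_of_nonneg_right hpos2)
    have e1 : V ^ (-(2 * a)) = V ^ (-(2 * a + 2)) * V ^ 2 := by
      rw [← Real.rpow_add_natCast hV.ne']
      norm_num
    rw [e1]
    calc V ^ (-(2 * a + 2)) * V ^ 2 * (p ^ 6 / R ^ 2)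
        ≤ V ^ (-(2 * a + 2)) * (δ * R * p) ^ 2 * (p ^ 6 / R ^ 2) := by gcongr
      _ = δ ^ 2 * (V ^ (-(2 * a + 2)) * p ^ 8) := by field_simp
  · refine le_trans ?_ (le_add_of_nonneg_left hpos1)
    have hd : 0 < δ * R * p := by positivity
    have h1 : V ^ (-(2 * a)) ≤ (δ * R * p) ^ (-(2 * a)) :=
      Real.rpow_le_rpow_of_nonpos hd h.le (by linarith)
    have e1 : R ^ (-(2 * a + 2)) = R ^ (-(2 * a)) / R ^ 2 := by
      rw [show -(2 * a + 2) = -(2 * a) - (2 : ℕ) by push_cast; ring, Real.rpow_sub_natCast hR.ne']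
    have e2 : p ^ (-(2 * a)) * p ^ 6 ≤ 1 := by
      rw [← Real.rpow_add_natCast hp.ne']
      exact Real.rpow_le_one hp.le hp1 (by push_cast; linarith)
    calc V ^ (-(2 * a)) * (p ^ 6 / R ^ 2) ≤ (δ * R * p) ^ (-(2 * a)) * (p ^ 6 / R ^ 2) := by gcongr
      _ = δ ^ (-(2 * a)) * R ^ (-(2 * a)) / R ^ 2 * (p ^ (-(2 * a)) * p ^ 6) := by
        rw [Real.mul_rpow (by positivity) hp.le, Real.mul_rpow hδ.le hR.le]
        ring
      _ ≤ δ ^ (-(2 * a)) * R ^ (-(2 * a)) / R ^ 2 * 1 := by gcongr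
      _ = δ ^ (-(2 * a)) * R ^ (-(2 * a + 2)) := by rw [e1]; ring

theorem volume_real_ball (x : 𝔼) {r : ℝ} (hr : 0 < r) :
    volume.real (Metric.ball x r) = r ^ n * volume.real (Metric.ball (0 : 𝔼) 1) := by
  rw [Measure.real, Measure.addHaar_ball_of_pos volume x hr, ENNReal.toReal_mul,
    ENNReal.toReal_ofReal (by positivity), finrank_euclideanSpace_fin]
  rfl

theorem volume_real_unit_ball_pos : 0 < volume.real (Metric.ball (0 : 𝔼) 1) :=
  ENNReal.toReal_pos (Metric.measure_ball_pos _ _ one_pos).ne' measure_ball_lt_top.ne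

theorem integrableOn_ball_of_continuous {f : 𝔼 → ℝ} (hf : Continuous f) (x : 𝔼) (r : ℝ) :
    IntegrableOn f (Metric.ball x r) :=
  (hf.continuousOn.integrableOn_compact (isCompact_closedBall x r)).mono_set
    Metric.ball_subset_closedBall

theorem IsStableSolutionOn.continuous_rpow {W : Set 𝔼} {v : 𝔼 → ℝ} (hv : IsStableSolutionOn W v)
    (b : ℝ) : Continuous fun x => v x ^ b :=
  hv.contDiff.continuous.rpow_const fun x => Or.inl (hv.pos x).ne'

/-- Scale invariant interior estimate for negative powers of a stable solution. -/
theorem exists_setIntegral_rpow_le {a : ℝ} (ha0 : 0 < a) (ha : a ^ 2 < 2 * a + 1) :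
    ∃ C : ℝ, 0 < C ∧ ∀ {W : Set 𝔼} {v : 𝔼 → ℝ} (x : 𝔼) (R : ℝ), IsStableSolutionOn W v →
      0 < R → Metric.closedBall x R ⊆ W →
      ∫ y in Metric.ball x (R / 2), v y ^ (-(2 * a + 2)) ≤ C * R ^ ((n : ℝ) - (2 * a + 2)) := by
  obtain ⟨C, hC, hmain⟩ := exists_integral_rpow_mul_sq_le (n := n) ha
  have ha3 : a ≤ 3 := by nlinarith
  let β := volume.real (Metric.ball (0 : 𝔼) 1)
  have hβ : 0 < β := volume_real_unit_ball_pos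
  -- Chosen so that the term to be absorbed has coefficient `1/2`; the 64 is the square of the 8 in
  -- the gradient of the cutoff.
  let δ : ℝ := Real.sqrt (1 / (128 * C))
  have hδ : 0 < δ := Real.sqrt_pos.2 (by positivity)
  have hδ2 : C * (64 * δ ^ 2) = 1 / 2 := by
    rw [Real.sq_sqrt (by positivity)]
    field_simp
    norm_num
  let c₁ : ℝ := 2 * (C * (64 * (δ ^ (-(2 * a)) * β)))
  have hc₁ : 0 < c₁ := by positivity
  refine ⟨c₁ / (3 / 4) ^ 8, by positivity, ?_⟩
  intro W v x R hv hR hsub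
  let P : 𝔼 → ℝ := fun z => truncParaboloid (R⁻¹ • (z - x))
  have hnorm : ∀ z, ‖R⁻¹ • (z - x)‖ = dist z x / R := fun z => by
    rw [norm_smul, norm_inv, Real.norm_of_nonneg hR.le, dist_eq_norm, div_eq_inv_mul]
  have hPc : Continuous P := continuous_truncParaboloid.comp (by fun_prop)
  have hP0 : ∀ z, 0 ≤ P z := fun z => truncParaboloid_nonneg _
  have hP1 : ∀ z, P z ≤ 1 := fun z => truncParaboloid_le_one _
  have hPz : ∀ z ∉ Metric.ball x R, P z = 0 := fun z hz => by
    refine truncParaboloid_eq_zero ?_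
    rw [hnorm, le_div_iff₀ hR, one_mul]
    exact not_lt.1 hz
  let φ : 𝔼 → ℝ := fun z => P z ^ 4
  have hφ : ContDiff ℝ 1 φ := contDiff_truncParaboloid_pow_four.comp
    (by fun_prop : ContDiff ℝ 1 fun z : 𝔼 => R⁻¹ • (z - x))
  have hφs : Function.support φ ⊆ Metric.closedBall x R := fun z hz => by
    by_contra h
    exact hz (by simp [φ, hPz z fun h' => h (Metric.ball_subset_closedBall h')])
  have hφt : tsupport φ ⊆ Metric.closedBall x R := closure_minimal hφs Metric.isClosed_closedBall
  have hφc : HasCompactSupport φ :=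
    HasCompactSupport.of_support_subset_isCompact (isCompact_closedBall x R) hφs
  have hgrad : ∀ z, ‖∇ φ z‖ ^ 2 ≤ 64 * (P z ^ 6 / R ^ 2) := by
    intro z
    have h1 := (hasGradientAt_truncParaboloid_pow_four (R⁻¹ • (z - x))).comp_smul_sub
    have h2 : ∇ φ z = _ := h1.gradient
    by_cases hz : z ∈ Metric.ball x R
    · have h3 : dist z x / R ≤ 1 := (div_le_one hR).2 (Metric.mem_ball.1 hz).le
      have h4 : 0 ≤ dist z x / R := by positivity
      rw [h2, norm_smul, norm_smul, hnorm, norm_inv, Real.norm_of_nonneg hR.le, norm_mul, norm_pow,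
        Real.norm_of_nonneg (truncParaboloid_nonneg _)]
      change (R⁻¹ * (‖(-8 : ℝ)‖ * P z ^ 3 * (dist z x / R))) ^ 2 ≤ _
      rw [show ‖(-8 : ℝ)‖ = 8 by norm_num]
      calc (R⁻¹ * (8 * P z ^ 3 * (dist z x / R))) ^ 2 ≤ (R⁻¹ * (8 * P z ^ 3 * 1)) ^ 2 := by
            have := hP0 z
            gcongr
        _ = 64 * (P z ^ 6 / R ^ 2) := by field_simp; ring
    · have h3 : truncParaboloid (R⁻¹ • (z - x)) = 0 := hPz z hz
      rw [h2, h3]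
      have := hP0 z
      simp
      positivity
  have hI := hmain hv hφ hφc (hφt.trans hsub)
  set I := ∫ z, v z ^ (-(2 * a + 2)) * φ z ^ 2 with hIdef
  have hφ2 : ∀ z, φ z ^ 2 = P z ^ 8 := fun z => by simp only [φ]; ring
  have hIint : Integrable fun z => v z ^ (-(2 * a + 2)) * φ z ^ 2 :=
    Continuous.integrable_of_hasCompactSupport ((hv.continuous_rpow _).mul (hφ.continuous.pow 2))
      (HasCompactSupport.intro hφc.isCompact fun z hz => by
        simp [image_eq_zero_of_notMem_tsupport hz])
  have hKint : Integrable fun z => v z ^ (-(2 * a)) * ‖∇ φ z‖ ^ 2 :=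
    Continuous.integrable_of_hasCompactSupport
      ((hv.continuous_rpow _).mul (hφ.continuous_gradient.norm.pow 2))
      (HasCompactSupport.intro hφc.isCompact fun z hz => by
        simp [gradient_eq_zero_of_notMem_tsupport hz])
  let c : ℝ := δ ^ (-(2 * a)) * R ^ (-(2 * a + 2))
  have hc : 0 < c := by positivity
  have hind : Integrable ((Metric.ball x R).indicator fun _ => c) :=
    (integrable_indicator_iff measurableSet_ball).2 (integrableOn_const measure_ball_lt_top.ne)
  have hK : ∫ z, v z ^ (-(2 * a)) * ‖∇ φ z‖ ^ 2 ≤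
      64 * (δ ^ 2 * I + c * (R ^ n * β)) := by
    calc ∫ z, v z ^ (-(2 * a)) * ‖∇ φ z‖ ^ 2
        ≤ ∫ z, 64 * (δ ^ 2 * (v z ^ (-(2 * a + 2)) * φ z ^ 2)
            + (Metric.ball x R).indicator (fun _ => c) z) := by
          refine integral_mono hKint (((hIint.const_mul _).add hind).const_mul _) fun z => ?_
          have h1 := Real.rpow_nonneg (hv.pos z).le (-(2 * a))
          by_cases hz : z ∈ Metric.ball x R
          · have h2 := rpow_mul_pow_six_div_sq_le ha0 ha3 (hv.pos z) (hP0 z) (hP1 z) hR hδ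
            have h3 := mul_le_mul_of_nonneg_left (hgrad z) h1
            simp only [indicator_of_mem hz, hφ2]
            simp only [c]
            linarith
          · have h3 := hgrad z
            rw [hPz z hz] at h3
            have h4 : ‖∇ φ z‖ ^ 2 = 0 := le_antisymm (by simpa using h3) (sq_nonneg _)
            simp [h4, indicator_of_notMem hz, φ, hPz z hz]
      _ = 64 * (δ ^ 2 * I + c * (R ^ n * β)) := by
          rw [integral_const_mul, integral_add (hIint.const_mul _) hind, integral_const_mul,
            integral_indicator measurableSet_ball, setIntegral_const, volume_real_ball x hR,
            smul_eq_mul]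
          ring
  -- Absorption: half of `I` moves to the left side.
  have hI2 : I ≤ c₁ * R ^ ((n : ℝ) - (2 * a + 2)) := by
    have h1 : I ≤ C * (64 * (δ ^ 2 * I + c * (R ^ n * β))) :=
      hI.trans (mul_le_mul_of_nonneg_left hK hC.le)
    have h2 : R ^ ((n : ℝ) - (2 * a + 2)) = R ^ (-(2 * a + 2)) * R ^ n := by
      rw [← Real.rpow_add_natCast hR.ne']
      ring_nf
    have h3 : C * (64 * (δ ^ 2 * I + c * (R ^ n * β))) =
        (C * (64 * δ ^ 2)) * I + 1 / 2 * (c₁ * R ^ ((n : ℝ) - (2 * a + 2))) := by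
      rw [h2]
      simp only [c, c₁]
      ring
    rw [h3, hδ2] at h1
    linarith
  rw [div_mul_eq_mul_div, le_div_iff₀ (by norm_num)]
  refine le_trans ?_ hI2
  rw [← integral_mul_const]
  calc ∫ y in Metric.ball x (R / 2), v y ^ (-(2 * a + 2)) * (3 / 4) ^ 8
      ≤ ∫ y in Metric.ball x (R / 2), v y ^ (-(2 * a + 2)) * φ y ^ 2 := by
        refine setIntegral_mono_on
          (integrableOn_ball_of_continuous ((hv.continuous_rpow _).mul continuous_const) _ _)
          hIint.integrableOn measurableSet_ball fun y hy => ?_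
        have h1 : 3 / 4 ≤ P y := le_truncParaboloid (by
          rw [hnorm, div_le_iff₀ hR]
          linarith [Metric.mem_ball.1 hy])
        have h2 := Real.rpow_nonneg (hv.pos y).le (-(2 * a + 2))
        rw [hφ2]
        gcongr
    _ ≤ I := setIntegral_le_integral hIint (ae_of_all _ fun y =>
        mul_nonneg (Real.rpow_nonneg (hv.pos y).le _) (sq_nonneg _))

end Cutoff

/-! ### Growth of the mean and lower bounds for negative powers -/

section MeanValue

variable {n : ℕ}

local notation "𝔼" => EuclideanSpace ℝ (Fin n)

theorem setIntegral_ball_comp_add_smul (f : 𝔼 → ℝ) (x : 𝔼) {s : ℝ} (hs : 0 < s) (ρ : ℝ) :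
    ∫ y in Metric.ball (0 : 𝔼) ρ, f (x + s • y) =
      (s ^ n)⁻¹ * ∫ z in Metric.ball x (s * ρ), f z := by
  have h1 := Measure.setIntegral_comp_smul_of_pos volume (fun z => f (x + z))
    (Metric.ball (0 : 𝔼) ρ) hs
  rw [h1, finrank_euclideanSpace_fin, smul_eq_mul, smul_ball hs.ne', smul_zero,
    Real.norm_of_nonneg hs.le]
  congr 1
  have h2 := (measurePreserving_add_left volume x).setIntegral_preimage_emb
    (measurableEmbedding_addLeft x) f (Metric.ball x (s * ρ))
  rw [← h2]
  congr 2
  ext z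
  simp [dist_eq_norm]

/-- The exponent `a = 1` controls `v ^ (-4)`, and `1/v ≤ R³ v ^ (-4) + 1/R` by comparing `v` with
`R`. -/
theorem exists_setIntegral_inv_le : ∃ C : ℝ, 0 < C ∧ ∀ {W : Set 𝔼} {v : 𝔼 → ℝ} (x : 𝔼) (R : ℝ),
    IsStableSolutionOn W v → 0 < R → Metric.closedBall x R ⊆ W →
    ∫ y in Metric.ball x (R / 2), (v y)⁻¹ ≤ C * (R ^ n / R) := by
  obtain ⟨C, hC, hmain⟩ := exists_setIntegral_rpow_le (n := n) (a := 1) one_pos (by norm_num)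
  let β := volume.real (Metric.ball (0 : 𝔼) 1)
  have hβ : 0 < β := volume_real_unit_ball_pos
  refine ⟨C + β, by positivity, ?_⟩
  intro W v x R hv hR hsub
  have h1 := hmain x R hv hR hsub
  have e1 : R ^ ((n : ℝ) - (2 * 1 + 2)) = R ^ n / R ^ 4 := by
    rw [show (n : ℝ) - (2 * 1 + 2) = ((n : ℕ) : ℝ) - (4 : ℕ) by norm_num,
      Real.rpow_sub_natCast hR.ne', Real.rpow_natCast]
  rw [e1] at h1
  have hi1 := integrableOn_ball_of_continuous (hv.continuous_rpow (-(2 * 1 + 2))) x (R / 2)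
  calc ∫ y in Metric.ball x (R / 2), (v y)⁻¹
      ≤ ∫ y in Metric.ball x (R / 2), (R ^ 3 * v y ^ (-(2 * 1 + 2) : ℝ) + R⁻¹) := by
        refine setIntegral_mono_on (integrableOn_ball_of_continuous
          (hv.contDiff.continuous.inv₀ fun y => (hv.pos y).ne') _ _)
          ((hi1.const_mul _).add (integrableOn_const measure_ball_lt_top.ne))
          measurableSet_ball fun y _ => ?_
        have hy := hv.pos y
        have e2 : v y ^ (-(2 * 1 + 2) : ℝ) = (v y ^ 4)⁻¹ := by
          rw [Real.rpow_neg hy.le]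
          norm_num
        rw [e2]
        rcases le_or_gt R (v y) with h | h
        · have h2 : (v y)⁻¹ ≤ R⁻¹ := inv_anti₀ hR h
          have h3 : 0 ≤ R ^ 3 * (v y ^ 4)⁻¹ := by positivity
          linarith
        · have h2 : (v y)⁻¹ = v y ^ 3 * (v y ^ 4)⁻¹ := by field_simp
          have h3 : v y ^ 3 * (v y ^ 4)⁻¹ ≤ R ^ 3 * (v y ^ 4)⁻¹ := by gcongr
          have h4 : 0 ≤ R⁻¹ := by positivity
          linarith
    _ = R ^ 3 * (∫ y in Metric.ball x (R / 2), v y ^ (-(2 * 1 + 2) : ℝ))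
        + (R / 2) ^ n * β * R⁻¹ := by
        rw [integral_add (hi1.const_mul _) (integrableOn_const measure_ball_lt_top.ne),
          integral_const_mul, setIntegral_const, volume_real_ball x (half_pos hR), smul_eq_mul]
    _ ≤ R ^ 3 * (C * (R ^ n / R ^ 4)) + R ^ n * β * R⁻¹ := by
        gcongr
        linarith
    _ = (C + β) * (R ^ n / R) := by field_simp

theorem hasDerivAt_integral_comp_add_smul {v ψ : 𝔼 → ℝ} (hv : ContDiff ℝ 1 v) (hψ : Continuous ψ)
    (hc : HasCompactSupport ψ) (x : 𝔼) (s : ℝ) :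
    HasDerivAt (fun s => ∫ y, v (x + s • y) * ψ y)
      (∫ y, inner ℝ (∇ v (x + s • y)) y * ψ y) s := by
  have hcv := hv.continuous_gradient
  have hF' : Continuous fun z : ℝ × 𝔼 => inner ℝ (∇ v (x + z.1 • z.2)) z.2 * ψ z.2 := by fun_prop
  obtain ⟨M, hM⟩ := ((isCompact_closedBall s 1).prod hc.isCompact).exists_bound_of_continuousOn
    hF'.continuousOn
  refine (hasDerivAt_integral_of_dominated_loc_of_deriv_le
    (F := fun s y => v (x + s • y) * ψ y)
    (F' := fun s y => inner ℝ (∇ v (x + s • y)) y * ψ y)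
    (bound := (tsupport ψ).indicator fun _ => M)
    (Metric.closedBall_mem_nhds s one_pos) ?_ ?_ ?_ ?_ ?_ ?_).2
  · refine Eventually.of_forall fun t => Continuous.aestronglyMeasurable ?_
    have := hv.continuous
    fun_prop
  · refine Continuous.integrable_of_hasCompactSupport ?_ hc.mul_left
    have := hv.continuous
    fun_prop
  · exact Continuous.aestronglyMeasurable (by fun_prop)
  · refine ae_of_all _ fun y t ht => ?_
    by_cases hy : y ∈ tsupport ψ
    · rw [indicator_of_mem hy]
      exact hM (t, y) ⟨ht, hy⟩
    · simp [indicator_of_notMem hy, image_eq_zero_of_notMem_tsupport hy]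
  · exact (integrable_indicator_iff hc.isCompact.measurableSet).2
      (integrableOn_const hc.isCompact.measure_lt_top.ne)
  · refine ae_of_all _ fun y t _ => ?_
    have h1 : HasDerivAt (fun t : ℝ => x + t • y) y t := by
      simpa using ((hasDerivAt_id t).smul_const y).const_add x
    have h2 := ((hv.differentiable one_ne_zero (x + t • y)).hasFDerivAt.comp_hasDerivAt t h1).mul_const
      (ψ y)
    simp only [inner_gradient_left]
    exact h2

/-- The mean of a stable solution over a ball is controlled by its value at the center and
the radius. -/
theorem exists_setIntegral_ball_le : ∃ C : ℝ, 0 < C ∧ ∀ {W : Set 𝔼} {v : 𝔼 → ℝ} (x : 𝔼) (r : ℝ),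
    IsStableSolutionOn W v → 0 < r → Metric.closedBall x (2 * r) ⊆ W →
    ∫ y in Metric.ball x (r / 2), v y ≤ C * r ^ n * (v x + r) := by
  obtain ⟨C, hC, hmain⟩ := exists_setIntegral_inv_le (n := n)
  -- This weight satisfies `ψ y • y = -∇ g y`, so the radial derivative of the weighted mean becomes
  -- an integral of `Δv` by Green's identity.
  let ψ : 𝔼 → ℝ := fun y => 8 * truncParaboloid y ^ 3
  let g : 𝔼 → ℝ := fun y => truncParaboloid y ^ 4
  have hg : ContDiff ℝ 1 g := contDiff_truncParaboloid_pow_four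
  have hT0 : ∀ y : 𝔼, y ∉ Metric.ball (0 : 𝔼) 1 → truncParaboloid y = 0 := fun y hy =>
    truncParaboloid_eq_zero (by simpa using hy)
  have hgc : HasCompactSupport g := HasCompactSupport.intro (isCompact_closedBall (0 : 𝔼) 1)
    fun y hy => by simp [g, hT0 y fun h => hy (Metric.ball_subset_closedBall h)]
  have hψ : Continuous ψ := continuous_const.mul (continuous_truncParaboloid.pow 3)
  have hψ0 : ∀ y, 0 ≤ ψ y := fun y => by
    have := truncParaboloid_nonneg y
    positivity
  have hψc : HasCompactSupport ψ := HasCompactSupport.intro (isCompact_closedBall (0 : 𝔼) 1)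
    fun y hy => by simp [ψ, hT0 y fun h => hy (Metric.ball_subset_closedBall h)]
  have hψi : Integrable ψ := hψ.integrable_of_hasCompactSupport hψc
  have hψI : 0 ≤ ∫ y, ψ y := integral_nonneg hψ0
  refine ⟨(∫ y, ψ y) + C * 2 ^ n, by positivity, ?_⟩
  intro W v x r hv hr hsub
  have hv1 : ContDiff ℝ 1 v := hv.contDiff.of_le (by norm_num)
  let f : ℝ → ℝ := fun s => ∫ y, v (x + s • y) * ψ y
  have hf : ∀ s, HasDerivAt f (∫ y, inner ℝ (∇ v (x + s • y)) y * ψ y) s := fun s =>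
    hasDerivAt_integral_comp_add_smul hv1 hψ hψc x s
  -- The powers of `s` cancel: the derivative is at most `s · s⁻ⁿ` times a bound of order `sⁿ / s`.
  -- Hence the mean grows at most linearly.
  have hf' : ∀ s ∈ Ioo 0 r, deriv f s ≤ C * 2 ^ n := by
    rintro s ⟨hs0, hsr⟩
    have hball : ∀ y ∈ Metric.ball (0 : 𝔼) 1, x + s • y ∈ W := fun y hy => by
      refine hsub ?_
      rw [Metric.mem_closedBall, dist_self_add_left, norm_smul, Real.norm_of_nonneg hs0.le]
      nlinarith [mem_ball_zero_iff.1 hy, norm_nonneg y]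
    have e1 : ∀ y, inner ℝ (∇ v (x + s • y)) y * ψ y =
        -inner ℝ (∇ v (x + s • y)) (∇ g y) := by
      intro y
      rw [(hasGradientAt_truncParaboloid_pow_four y).gradient, inner_smul_right]
      simp only [ψ]
      ring
    have hvs : Continuous fun y : 𝔼 => (v (x + s • y))⁻¹ :=
      (hv.contDiff.continuous.comp (by fun_prop)).inv₀ fun y => (hv.pos _).ne'
    have h2 : ∫ y, g y * Laplacian.laplacian v (x + s • y) ≤
        ∫ y in Metric.ball (0 : 𝔼) 1, (v (x + s • y))⁻¹ := by
      rw [← setIntegral_eq_integral_of_forall_compl_eq_zero (s := Metric.ball (0 : 𝔼) 1)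
        fun y hy => by simp [g, hT0 y hy]]
      rw [setIntegral_congr_fun (g := fun y => g y * (v (x + s • y))⁻¹) measurableSet_ball
        fun y hy => by simp only [hv.laplacian_eq _ (hball y hy), one_div]]
      refine setIntegral_mono_on (integrableOn_ball_of_continuous (hg.continuous.mul hvs) _ _)
        (integrableOn_ball_of_continuous hvs _ _) measurableSet_ball fun y _ => ?_
      exact mul_le_of_le_one_left (inv_nonneg.2 (hv.pos _).le)
        (pow_le_one₀ (truncParaboloid_nonneg y) (truncParaboloid_le_one y))
    have h3 := hmain x (2 * s) hv (by positivity)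
      ((Metric.closedBall_subset_closedBall (by linarith)).trans hsub)
    rw [mul_div_cancel_left₀ s two_ne_zero] at h3
    have h4 := setIntegral_ball_comp_add_smul (fun z => (v z)⁻¹) x hs0 1
    rw [mul_one] at h4
    rw [(hf s).deriv]
    simp only [e1]
    rw [integral_neg, ← integral_mul_laplacian_comp hv.contDiff hg hgc x s]
    calc s * ∫ y, g y * Laplacian.laplacian v (x + s • y)
        ≤ s * ((s ^ n)⁻¹ * (C * ((2 * s) ^ n / (2 * s)))) := by
          rw [h4] at h2
          refine mul_le_mul_of_nonneg_left (h2.trans ?_) hs0.le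
          gcongr
      _ = C * 2 ^ n / 2 := by
          rw [mul_pow]
          field_simp
      _ ≤ C * 2 ^ n := half_le_self (by positivity)
  have h1 : f r - f 0 ≤ C * 2 ^ n * (r - 0) := by
    refine (convex_Icc 0 r).image_sub_le_mul_sub_of_deriv_le
      (fun s _ => (hf s).continuousAt.continuousWithinAt)
      (fun s _ => (hf s).differentiableAt.differentiableWithinAt) ?_ 0
      (left_mem_Icc.2 hr.le) r (right_mem_Icc.2 hr.le) hr.le
    rw [interior_Icc]
    exact hf'
  have h2 : f 0 = v x * ∫ y, ψ y := by simp [f, integral_const_mul]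
  have h3 : ∫ y in Metric.ball (0 : 𝔼) (1 / 2), v (x + r • y) ≤ f r := by
    have hc : Continuous fun y : 𝔼 => v (x + r • y) := hv.contDiff.continuous.comp (by fun_prop)
    have hi : Integrable fun y => v (x + r • y) * ψ y :=
      (hc.mul hψ).integrable_of_hasCompactSupport hψc.mul_left
    calc ∫ y in Metric.ball (0 : 𝔼) (1 / 2), v (x + r • y)
        ≤ ∫ y in Metric.ball (0 : 𝔼) (1 / 2), v (x + r • y) * ψ y := by
          refine setIntegral_mono_on (integrableOn_ball_of_continuous hc _ _) hi.integrableOn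
            measurableSet_ball fun y hy => ?_
          refine le_mul_of_one_le_right (hv.pos _).le ?_
          have h5 : 3 / 4 ≤ truncParaboloid y := le_truncParaboloid (mem_ball_zero_iff.1 hy).le
          calc (1 : ℝ) ≤ 8 * (3 / 4) ^ 3 := by norm_num
            _ ≤ ψ y := by simp only [ψ]; gcongr
      _ ≤ f r := setIntegral_le_integral hi (ae_of_all _ fun y =>
          mul_nonneg (hv.pos _).le (hψ0 y))
  rw [setIntegral_ball_comp_add_smul v x hr, inv_mul_le_iff₀ (by positivity), mul_one_div] at h3
  have hvx := hv.pos x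
  calc ∫ y in Metric.ball x (r / 2), v y ≤ r ^ n * f r := h3
    _ ≤ r ^ n * (((∫ y, ψ y) + C * 2 ^ n) * (v x + r)) := by
      gcongr
      have : 0 ≤ (∫ y, ψ y) * r := by positivity
      have : 0 ≤ C * 2 ^ n * v x := by positivity
      nlinarith
    _ = _ := by ring

/-- An affine minorant of `t ^ (-q)`, so that an upper bound on the mean of `v` alone bounds the
integral of `v ^ (-q)` from below. -/
theorem one_sub_div_mul_rpow_le {q t M : ℝ} (hq : 0 ≤ q) (ht : 0 < t) (hM : 0 < M) :
    M ^ (-q) * (1 - t / M) ≤ t ^ (-q) := by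
  rcases le_or_gt t M with h | h
  · calc M ^ (-q) * (1 - t / M) ≤ M ^ (-q) * 1 := by
          gcongr
          linarith [div_pos ht hM]
      _ ≤ t ^ (-q) := by
          rw [mul_one]
          exact Real.rpow_le_rpow_of_nonpos ht h (by linarith)
  · have h1 : 1 - t / M ≤ 0 := sub_nonpos.2 ((one_le_div hM).2 h.le)
    exact (mul_nonpos_of_nonneg_of_nonpos (by positivity) h1).trans (by positivity)

/-- Lower bound for the integral of a negative power of a stable solution. -/
theorem exists_le_setIntegral_rpow {q : ℝ} (hq : 0 ≤ q) :
    ∃ c : ℝ, 0 < c ∧ ∀ {W : Set 𝔼} {v : 𝔼 → ℝ} (x : 𝔼) (r : ℝ),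
    IsStableSolutionOn W v → 0 < r → Metric.closedBall x (2 * r) ⊆ W →
    c * r ^ n * (v x + r) ^ (-q) ≤ ∫ y in Metric.ball x (r / 2), v y ^ (-q) := by
  obtain ⟨C, hC, hmain⟩ := exists_setIntegral_ball_le (n := n)
  let β := volume.real (Metric.ball (0 : 𝔼) 1)
  have hβ : 0 < β := volume_real_unit_ball_pos
  -- With this `K` the subtracted term is at most half the volume of the ball of radius `r / 2`.
  let K : ℝ := 2 * 2 ^ n * C / β
  have hK : 0 < K := by positivity
  refine ⟨K ^ (-q) * (β / (2 * 2 ^ n)), by positivity, ?_⟩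
  intro W v x r hv hr hsub
  have h1 := hmain x r hv hr hsub
  have hvx := hv.pos x
  have hm : 0 < v x + r := by positivity
  have hM : 0 < K * (v x + r) := by positivity
  have hi : IntegrableOn v (Metric.ball x (r / 2)) :=
    integrableOn_ball_of_continuous hv.contDiff.continuous _ _
  have hi1 : IntegrableOn (fun _ : 𝔼 => (1 : ℝ)) (Metric.ball x (r / 2)) :=
    integrableOn_const measure_ball_lt_top.ne
  calc K ^ (-q) * (β / (2 * 2 ^ n)) * r ^ n * (v x + r) ^ (-q)
      = (K * (v x + r)) ^ (-q) * ((r / 2) ^ n * β - C * r ^ n * (v x + r) / (K * (v x + r))) := by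
        have e : C * r ^ n * (v x + r) / (K * (v x + r)) = β * r ^ n / (2 * 2 ^ n) := by
          simp only [K]
          field_simp
        rw [Real.mul_rpow hK.le hm.le, e, div_pow]
        field_simp
        ring
    _ ≤ (K * (v x + r)) ^ (-q) * ((r / 2) ^ n * β
          - (∫ y in Metric.ball x (r / 2), v y) / (K * (v x + r))) := by gcongr
    _ = ∫ y in Metric.ball x (r / 2), (K * (v x + r)) ^ (-q) * (1 - v y / (K * (v x + r))) := by
        rw [integral_const_mul, integral_sub hi1 (hi.div_const _), integral_div, setIntegral_const,
          volume_real_ball x (half_pos hr), smul_eq_mul, mul_one]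
    _ ≤ ∫ y in Metric.ball x (r / 2), v y ^ (-q) :=
        setIntegral_mono_on ((hi1.sub (hi.div_const _)).const_mul _)
          (integrableOn_ball_of_continuous (hv.continuous_rpow _) _ _) measurableSet_ball
          fun y _ => one_sub_div_mul_rpow_le hq (hv.pos y) hM

end MeanValue

/-! ### From packing numbers to Hausdorff dimension -/

/-- A bound `C r ^ (-d)` for the cardinality of `r`-separated subsets bounds the Hausdorff
dimension by `d`. -/
theorem nonneg_and_dimH_le_of_card_mul_rpow_le {X : Type*} [MetricSpace X] {S : Set X}
    (hS : S.Nonempty) {d C ρ : ℝ} (hρ : 0 < ρ)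
    (h : ∀ r, 0 < r → r ≤ ρ → ∀ T : Finset X, (T : Set X) ⊆ S →
      (T : Set X).Pairwise (fun x y => r ≤ dist x y) → T.card * r ^ d ≤ C) :
    0 ≤ d ∧ dimH S ≤ ENNReal.ofReal d := by
  classical
  have hsing : ∀ r, 0 < r → r ≤ ρ → r ^ d ≤ C := by
    intro r hr hrρ
    obtain ⟨x, hx⟩ := hS
    simpa using h r hr hrρ {x} (by simpa using hx) (by simp)
  have hC : 0 < C := (Real.rpow_pos_of_pos hρ d).trans_le (hsing ρ hρ le_rfl)
  have hd : 0 ≤ d := by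
    -- A single point already gives `r ^ d ≤ C`, which fails for small `r` if `d < 0`.
    by_contra! hd
    have h1 : 0 < (C + 1) ^ d⁻¹ := by positivity
    have h2 := hsing (min ρ ((C + 1) ^ d⁻¹)) (lt_min hρ h1) (min_le_left _ _)
    have h3 : ((C + 1) ^ d⁻¹) ^ d ≤ (min ρ ((C + 1) ^ d⁻¹)) ^ d :=
      Real.rpow_le_rpow_of_nonpos (lt_min hρ h1) (min_le_right _ _) hd.le
    rw [← Real.rpow_mul (by positivity), inv_mul_cancel₀ hd.ne, Real.rpow_one] at h3
    linarith
  refine ⟨hd, ?_⟩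
  borelize X
  have hcover : ∀ r, 0 < r → r ≤ ρ → ∃ T : Finset X, S ⊆ ⋃ x : T, Metric.ball (x : X) r ∧
      T.card * r ^ d ≤ C := by
    intro r hr hrρ
    -- A separated set of maximal cardinality is an `r`-net: an uncovered point could be added to
    -- it.
    let P : Finset X → Prop := fun T =>
      (T : Set X) ⊆ S ∧ (T : Set X).Pairwise (fun x y => r ≤ dist x y)
    have hPb : BddAbove {k | ∃ T, P T ∧ T.card = k} := by
      refine ⟨⌊C / r ^ d⌋₊, ?_⟩
      rintro _ ⟨T, hT, rfl⟩
      refine Nat.le_floor ?_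
      rw [le_div_iff₀ (by positivity)]
      exact h r hr hrρ T hT.1 hT.2
    obtain ⟨T, hT, hTk⟩ := Nat.sSup_mem (s := {k | ∃ T, P T ∧ T.card = k})
      ⟨0, ∅, ⟨by simp, by simp⟩, rfl⟩ hPb
    refine ⟨T, fun x hx => ?_, h r hr hrρ T hT.1 hT.2⟩
    by_contra hxT
    have hfar : ∀ y ∈ T, r ≤ dist x y := by
      intro y hy
      by_contra! hlt
      exact hxT (mem_iUnion.2 ⟨⟨y, hy⟩, hlt⟩)
    have hxn : x ∉ T := fun hxT' => by
      have := hfar x hxT'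
      rw [dist_self] at this
      linarith
    have hins : P (insert x T) := by
      refine ⟨by simpa [insert_subset_iff] using ⟨hx, hT.1⟩, ?_⟩
      rw [Finset.coe_insert]
      refine hT.2.insert fun y hy _ => ⟨hfar y hy, ?_⟩
      rw [dist_comm]
      exact hfar y hy
    have h1 := le_csSup hPb ⟨insert x T, hins, rfl⟩
    rw [Finset.card_insert_of_notMem hxn] at h1
    omega
  have hrpos : ∀ k : ℕ, 0 < ρ / (k + 1) := fun k => by positivity
  choose T hTS hTC using fun k : ℕ => hcover (ρ / (k + 1)) (hrpos k) (div_le_self hρ.le (by simp))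
  have hr0 : Tendsto (fun k : ℕ => ENNReal.ofReal (2 * (ρ / (k + 1)))) atTop (𝓝 0) := by
    rw [← ENNReal.ofReal_zero]
    refine ENNReal.tendsto_ofReal ?_
    simpa [div_eq_mul_inv] using
      ((tendsto_one_div_add_atTop_nhds_zero_nat (𝕜 := ℝ)).const_mul ρ).const_mul 2
  have hdiam : ∀ (k : ℕ) (x : T k), Metric.ediam (Metric.ball (x : X) (ρ / (k + 1))) ≤
      ENNReal.ofReal (2 * (ρ / (k + 1))) := by
    intro k x
    refine Metric.ediam_le_of_forall_dist_le fun y hy z hz => ?_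
    have := dist_triangle_right y z (x : X)
    linarith [Metric.mem_ball.1 hy, Metric.mem_ball.1 hz]
  have hH := Measure.hausdorffMeasure_le_liminf_sum d S
    (fun k : ℕ => ENNReal.ofReal (2 * (ρ / (k + 1)))) hr0
    (fun k (x : T k) => Metric.ball (x : X) (ρ / (k + 1)))
    (Eventually.of_forall hdiam) (Eventually.of_forall hTS)
  have hsum : ∀ k : ℕ, ∑ x : T k, Metric.ediam (Metric.ball (x : X) (ρ / (k + 1))) ^ d ≤
      ENNReal.ofReal (2 ^ d * C) := by
    intro k
    calc ∑ x : T k, Metric.ediam (Metric.ball (x : X) (ρ / (k + 1))) ^ d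
        ≤ ∑ x : T k, ENNReal.ofReal (2 * (ρ / (k + 1))) ^ d :=
          Finset.sum_le_sum fun x _ => ENNReal.rpow_le_rpow (hdiam k x) hd
      _ = ENNReal.ofReal ((T k).card * (2 * (ρ / (k + 1))) ^ d) := by
          rw [Finset.sum_const, ENNReal.ofReal_rpow_of_pos (by positivity), ENNReal.ofReal_mul
            (by positivity), ENNReal.ofReal_natCast]
          simp
      _ ≤ ENNReal.ofReal (2 ^ d * C) := by
          refine ENNReal.ofReal_le_ofReal ?_
          rw [Real.mul_rpow zero_le_two (hrpos k).le, mul_left_comm]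
          exact mul_le_mul_of_nonneg_left (hTC k) (by positivity)
  have hfin : Measure.hausdorffMeasure d S ≠ ⊤ := by
    refine ne_top_of_le_ne_top ENNReal.ofReal_ne_top (hH.trans
      ((liminf_le_liminf (Eventually.of_forall hsum)).trans_eq (liminf_const _)))
  rw [ENNReal.ofReal]
  refine dimH_le_of_hausdorffMeasure_ne_top ?_
  rwa [Real.coe_toNNReal d hd]

/-! ### Packing bound for the singular set of the limit -/

section Limit

variable {n : ℕ}

local notation "𝔼" => EuclideanSpace ℝ (Fin n)

/-- For each `j`, the lower bounds on the disjoint balls of radius `r / 2` add up to at most the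
interior estimate on one fixed ball. The constants do not depend on `j`, and the finite sum passes
to the limit, where `u = 0` at the centers. -/
theorem exists_card_mul_rpow_le_of_tendsto {Ω : Set 𝔼} (hΩ : IsOpen Ω) {u : 𝔼 → ℝ}
    {U : ℕ → 𝔼 → ℝ} (hsol : ∀ j, IsPositiveSolution Ω (U j)) (hstable : ∀ j, IsStable Ω (U j))
    (hlim : ∀ x ∈ Ω, Tendsto (fun j => U j x) atTop (𝓝 (u x)))
    {a : ℝ} (ha0 : 0 < a) (ha : a ^ 2 < 2 * a + 1) {x₀ : 𝔼} (hx₀ : x₀ ∈ Ω) :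
    ∃ ρ > 0, ∃ C : ℝ, ∀ r, 0 < r → r ≤ ρ → ∀ T : Finset 𝔼,
      (T : Set 𝔼) ⊆ singularSet Ω u ∩ Metric.ball x₀ ρ →
      (T : Set 𝔼).Pairwise (fun x y => r ≤ dist x y) →
      T.card * r ^ ((n : ℝ) - (2 * a + 2)) ≤ C := by
  obtain ⟨ε, hε, hεΩ⟩ := Metric.nhds_basis_closedBall.mem_iff.1 (hΩ.mem_nhds hx₀)
  obtain ⟨C, hC, hupper⟩ := exists_setIntegral_rpow_le (n := n) ha0 ha
  obtain ⟨c, hc, hlower⟩ := exists_le_setIntegral_rpow (n := n) (q := 2 * a + 2) (by positivity)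
  -- With `r ≤ ε / 16`, the balls of radius `2 * r` about the points stay in the ball of radius `ε /
  -- 2` where `v` solves the equation, and those of radius `r / 2` in the ball of radius `ε / 8`.
  refine ⟨ε / 16, by positivity, C * (ε / 4) ^ ((n : ℝ) - (2 * a + 2)) / c, ?_⟩
  intro r hr hrρ T hTA hTsep
  have hT0 : ∀ x ∈ T, dist x x₀ < ε / 16 := fun x hx => (hTA hx).2
  have hbound : ∀ j, ∑ x ∈ T, c * r ^ n * (U j x + r) ^ (-(2 * a + 2)) ≤
      C * (ε / 4) ^ ((n : ℝ) - (2 * a + 2)) := by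
    intro j
    obtain ⟨v, hv, hvu⟩ := (hsol j).exists_isStableSolutionOn hΩ (hstable j) (half_pos hε)
      (x₀ := x₀) (by rwa [mul_div_cancel₀ ε two_ne_zero])
    have hint : ∀ (x : 𝔼) (s : ℝ), IntegrableOn (fun y => v y ^ (-(2 * a + 2))) (Metric.ball x s) :=
      fun x s => integrableOn_ball_of_continuous (hv.continuous_rpow _) x s
    calc ∑ x ∈ T, c * r ^ n * (U j x + r) ^ (-(2 * a + 2))
        ≤ ∑ x ∈ T, ∫ y in Metric.ball x (r / 2), v y ^ (-(2 * a + 2)) := by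
          refine Finset.sum_le_sum fun x hx => ?_
          have hx0 := hT0 x hx
          rw [← hvu (Metric.mem_ball.2 (by linarith : dist x x₀ < ε / 2))]
          refine hlower x r hv hr fun y hy => ?_
          have h1 := Metric.mem_closedBall.1 hy
          have h2 := dist_triangle y x x₀
          exact Metric.mem_ball.2 (by linarith)
      _ = ∫ y in ⋃ x ∈ T, Metric.ball x (r / 2), v y ^ (-(2 * a + 2)) := by
          rw [integral_biUnion_finset T (fun x _ => measurableSet_ball) ?_ fun x _ => hint x _]
          intro x hx y hy hxy
          exact Metric.ball_disjoint_ball (by linarith [hTsep hx hy hxy])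
      _ ≤ ∫ y in Metric.ball x₀ (ε / 4 / 2), v y ^ (-(2 * a + 2)) := by
          refine setIntegral_mono_set (hint _ _)
            (ae_of_all _ fun y => Real.rpow_nonneg (hv.pos y).le _)
            (LE.le.eventuallyLE ?_)
          refine iUnion₂_subset fun x hx => Metric.ball_subset_ball' ?_
          linarith [hT0 x hx]
      _ ≤ C * (ε / 4) ^ ((n : ℝ) - (2 * a + 2)) :=
          hupper x₀ (ε / 4) hv (by positivity) (Metric.closedBall_subset_ball (by linarith))
  have htend : Tendsto (fun j => ∑ x ∈ T, c * r ^ n * (U j x + r) ^ (-(2 * a + 2))) atTop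
      (𝓝 (∑ x ∈ T, c * r ^ n * (0 + r) ^ (-(2 * a + 2)))) := by
    refine tendsto_finsetSum T fun x hx => ?_
    have h1 := hlim x (hTA hx).1.1
    rw [(hTA hx).1.2] at h1
    exact ((h1.add_const r).rpow_const (Or.inl (by simpa using hr.ne'))).const_mul _
  have hle := le_of_tendsto' htend hbound
  rw [Finset.sum_const, nsmul_eq_mul, zero_add] at hle
  rw [le_div_iff₀ hc]
  refine le_trans (le_of_eq ?_) hle
  rw [show (n : ℝ) - (2 * a + 2) = -(2 * a + 2) + n by ring, Real.rpow_add_natCast hr.ne']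
  ring

end Limit

/-! ### The optimal exponent -/

/-- For a nonempty singular set the bound forces `n ≥ 7`; equivalently, the singular set is
empty when `n ≤ 6` (the dimension of the empty set being `-∞`). -/
theorem mainTheorem6 (n : ℕ) (Ω : Set (EuclideanSpace ℝ (Fin n))) (hΩ : IsOpen Ω)
    (u : EuclideanSpace ℝ (Fin n) → ℝ) (U : ℕ → EuclideanSpace ℝ (Fin n) → ℝ)
    (hsol : ∀ j, IsPositiveSolution Ω (U j)) (hstable : ∀ j, IsStable Ω (U j))
    (hlim : TendstoLocallyUniformlyOn U u atTop Ω) :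
    (singularSet Ω u).Nonempty →
      (dimH (singularSet Ω u) : EReal) ≤ (((n : ℝ) - 4 - 2 * Real.sqrt 2 : ℝ) : EReal) := by
  rintro ⟨z, hz⟩
  have hs2 : 0 < Real.sqrt 2 := by positivity
  have hloc : ∀ a : ℝ, 1 ≤ a → a < 1 + Real.sqrt 2 → ∀ x ∈ singularSet Ω u,
      0 ≤ (n : ℝ) - (2 * a + 2) ∧ ∃ t ∈ 𝓝[singularSet Ω u] x,
        dimH t ≤ ENNReal.ofReal ((n : ℝ) - (2 * a + 2)) := by
    intro a ha1 ha2 x hx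
    have ha : a ^ 2 < 2 * a + 1 := by
      have : (a - 1) ^ 2 < 2 := (Real.lt_sqrt (by linarith)).1 (by linarith)
      nlinarith
    obtain ⟨ρ, hρ, C, h⟩ := exists_card_mul_rpow_le_of_tendsto hΩ hsol hstable
      (fun y hy => hlim.tendsto_at hy) (by linarith) ha hx.1
    have hne : (singularSet Ω u ∩ Metric.ball x ρ).Nonempty := ⟨x, hx, Metric.mem_ball_self hρ⟩
    obtain ⟨h1, h2⟩ := nonneg_and_dimH_le_of_card_mul_rpow_le hne hρ h
    exact ⟨h1, _, inter_mem_nhdsWithin _ (Metric.ball_mem_nhds x hρ), h2⟩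
  -- Otherwise some admissible `a` already has `n < 2a + 2`, contradicting the local nonnegativity.
  have hd : 0 ≤ (n : ℝ) - 4 - 2 * Real.sqrt 2 := by
    by_contra! hd
    have hmax : max 1 ((n : ℝ) / 2 - 1) < 1 + Real.sqrt 2 := max_lt (by linarith) (by linarith)
    obtain ⟨a, ha1, ha2⟩ := exists_between hmax
    have h1 := (hloc a ((le_max_left _ _).trans ha1.le) ha2 z hz).1
    linarith [(le_max_right _ _).trans_lt ha1]
  have hdim : dimH (singularSet Ω u) ≤ ENNReal.ofReal ((n : ℝ) - 4 - 2 * Real.sqrt 2) := by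
    by_contra! hlt
    obtain ⟨r, hr1, hr2⟩ := exists_between hlt
    -- Dimension exceeding `r` must be visible in every neighborhood of some point, so the local
    -- bounds suffice.
    obtain ⟨x, hx, hxt⟩ := exists_mem_nhdsWithin_lt_dimH_of_lt_dimH hr2
    have hrtop : r ≠ ⊤ := hr2.ne_top
    have hr3 : (n : ℝ) - 4 - 2 * Real.sqrt 2 < r.toReal :=
      (ENNReal.ofReal_lt_iff_lt_toReal hd hrtop).1 hr1
    -- The second entry solves `n - (2a + 2) = r`; raising it to `1` only lowers the local bound.
    obtain ⟨t, ht, hdt⟩ := (hloc (max 1 (((n : ℝ) - 2 - r.toReal) / 2)) (le_max_left _ _)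
      (max_lt (by linarith) (by linarith)) x hx).2
    refine absurd (hxt t ht) (not_lt.2 (hdt.trans (ENNReal.ofReal_le_of_le_toReal ?_)))
    linarith [le_max_right 1 (((n : ℝ) - 2 - r.toReal) / 2)]
  refine (EReal.coe_ennreal_le_coe_ennreal_iff.2 hdim).trans_eq ?_
  rw [EReal.coe_ennreal_ofReal, max_eq_left hd]
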